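/- There are an algorithm $A$ and a constant $C<\infty$ such that the following holds for every $p\in[2/3,1]$. Neither $A$ nor $C$ depends on $p$, and $p$ is not given to $A$. The algorithm is a computable procedure that may, at each step, request a fresh trial from $\mathrm{Bern}(p)$, flip a fair coin of its own, or halt and return a bit; all trials and all fair coin flips are jointly independent. Then the bit returned by $A$ is distributed exactly as $\mathrm{Bern}(1/(2p))$, that is, $A$ returns $1$ with probability $\frac{1}{2p}$ and $0$ with probability $1-\frac{1}{2p}$ (so it halts almost surely), and the expected number of trials from $\mathrm{Bern}(p)$ that $A$ performs is at most $C$. -/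

import Mathlib

open MeasureTheory ProbabilityTheory
open scoped ENNReal NNReal

/-- What an algorithm with access to a coin of unknown bias does in a given state: it requests a
fresh trial of the unknown coin, or it flips a fair coin of its own, or it halts and returns a
bit. -/
inductive CoinAction where
  | trial : CoinAction
  | flip : CoinAction
  | ret : Bool → CoinAction

/-- The actions form a four-element type; this is an explicit coding of it. -/
def CoinAction.equivSum : CoinAction ≃ Bool ⊕ Bool where
  toFun
    | .trial => Sum.inl true
    | .flip => Sum.inl false
    | .ret b => Sum.inr b
  invFun
    | Sum.inl true => .trial
    | Sum.inl false => .flip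
    | Sum.inr b => .ret b
  left_inv a := by cases a <;> rfl
  right_inv s := by rcases s with (_ | _) | _ <;> rfl

instance CoinAction.instPrimcodable : Primcodable CoinAction :=
  Primcodable.ofEquiv (Bool ⊕ Bool) CoinAction.equivSum

/-- A randomized algorithm with access to independent trials of a coin of unknown bias: a machine
whose states are coded by natural numbers, with a computable choice of the action to take in each
state, and a computable rule for the next state, given the current state and the answer (a bit) to
the request that was made in it. The bias of the coin does not enter. -/
structure CoinAlgorithm where
  State : Type
  [primcodable : Primcodable State]
  init : State
  action : State → CoinAction
  next : State → Bool → State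
  computable_action : Computable action
  computable_next : Computable₂ next

namespace CoinAlgorithm

/-- A configuration: the state, the number of trials of the unknown coin performed so far, and the
number of fair coins flipped so far. -/
structure Config (A : CoinAlgorithm) where
  state : A.State
  trials : ℕ
  flips : ℕ

/-- One step, when `x` lists the results of the trials of the unknown coin and `u` those of the
fair coin flips, each in the order in which they are requested. A halting state is kept forever. -/
def step (A : CoinAlgorithm) (x u : ℕ → Bool) (c : A.Config) : A.Config :=
  match A.action c.state with
  | .trial => ⟨A.next c.state (x c.trials), c.trials + 1, c.flips⟩
  | .flip => ⟨A.next c.state (u c.flips), c.trials, c.flips + 1⟩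
  | .ret _ => c

/-- The configuration after `t` steps. -/
def run (A : CoinAlgorithm) (x u : ℕ → Bool) (t : ℕ) : A.Config :=
  (A.step x u)^[t] ⟨A.init, 0, 0⟩

/-- The algorithm halts and returns the bit `b`. -/
def Returns (A : CoinAlgorithm) (x u : ℕ → Bool) (b : Bool) : Prop :=
  ∃ t, A.action (A.run x u t).state = .ret b

/-- The total number of trials of the unknown coin that the algorithm performs (`⊤` if it performs
infinitely many). -/
noncomputable def numTrials (A : CoinAlgorithm) (x u : ℕ → Bool) : ℕ∞ :=
  ⨆ t, ((A.run x u t).trials : ℕ∞)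

end CoinAlgorithm

/-- `X 0, X 1, …` are trials from `Bern(p)` and `U 0, U 1, …` are fair coin flips, and all of these
are jointly independent. -/
structure IsCoinSource {Ω : Type*} [MeasurableSpace Ω] (P : Measure Ω) (p : ℝ)
    (X U : ℕ → Ω → Bool) : Prop where
  measurable_trial : ∀ i, Measurable (X i)
  measurable_flip : ∀ i, Measurable (U i)
  prob_trial : ∀ i, P {ω | X i ω = true} = ENNReal.ofReal p
  prob_flip : ∀ i, P {ω | U i ω = true} = ENNReal.ofReal (1 / 2)
  indep : iIndepFun (fun i : ℕ ⊕ ℕ => (Sum.elim X U i : Ω → Bool)) P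

/-! With $r=(1-p)/p\le 1/2$ one has $1/(2p)=\frac12(1+r)$, so one fair choice reduces the task to a
bit of mean $r$. This is the probability that a walk with up-probability $p$ and down-probability
$1-p$ reaches $0$ from $1$; but for $r<1$ that walk may escape to infinity, and simulating it need
not halt.

The remedy is to slow the upward moves. If they are accepted with probability $u$, the walk has the
harmonic function $x^n$, $x=r/u$. Passing from level $N$ to $N+1$ lowers $u_N=3(N+2)/(4N)$, which
raises $x_N$ by a factor free of $p$: $x_N/x_{N+1}=N(N+3)/((N+1)(N+2))$. So at height $N+1$ the
algorithm can give up with a known probability and continue at level $N+1$ without changing the mean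
of the result. Since $u_6=1$, the site $(6,1)$ has value exactly $r$. Harmonicity is
`siteValue_eq_trial` and `stateMean_enter_siteValue`.

For the cost, $u_N\ge 3/4$ and $p\ge 2/3$ give upward drift at least $1/6$, and the chance to
survive the passage is at most $1-2/(N+4)$, small enough for the linear potential $20(4N-n)$ to
decrease on average (`siteBound_trial`, `stateMean_enter_siteBound`). `distribution_of_harmonic`
turns these two functions into the law of the result and the bound on the trials. -/

namespace CoinAlgorithm

variable {A : CoinAlgorithm}

/-! ### Runs as functions of the requested answers -/

theorem run_succ (x u : ℕ → Bool) (t : ℕ) : A.run x u (t + 1) = A.step x u (A.run x u t) :=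
  Function.iterate_succ_apply' _ _ _

theorem trials_le_step (x u : ℕ → Bool) (c : A.Config) : c.trials ≤ (A.step x u c).trials := by
  unfold step
  split <;> simp

theorem flips_le_step (x u : ℕ → Bool) (c : A.Config) : c.flips ≤ (A.step x u c).flips := by
  unfold step
  split <;> simp

/-- The configuration is determined by the answers that were requested on the way to it. -/
theorem run_congr {x u x' u' : ℕ → Bool} (t : ℕ) (hx : ∀ i < (A.run x u t).trials, x' i = x i)
    (hu : ∀ i < (A.run x u t).flips, u' i = u i) : A.run x' u' t = A.run x u t := by
  induction t with
  | zero => rfl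
  | succ t ih =>
    rw [run_succ] at hx hu
    have key := ih (fun i hi => hx i (hi.trans_le (trials_le_step _ _ _)))
      (fun i hi => hu i (hi.trans_le (flips_le_step _ _ _)))
    rw [run_succ, run_succ, key]
    generalize A.run x u t = c at *
    unfold step at *
    split <;> simp_all

instance : Countable A.State :=
  have := A.primcodable
  inferInstance

instance : Countable A.Config :=
  Function.Injective.countable (f := fun c : A.Config => (c.state, c.trials, c.flips))
    (by rintro ⟨⟩ ⟨⟩ h; simp_all)

/-- The conditional expectation of `φ` at the next state, for a coin of bias `p`. -/
noncomputable def nextMean (A : CoinAlgorithm) (p : ℝ) (φ : A.State → ℝ≥0∞) (s : A.State) :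
    ℝ≥0∞ :=
  match A.action s with
  | .trial => ENNReal.ofReal p * φ (A.next s true) + ENNReal.ofReal (1 - p) * φ (A.next s false)
  | .flip => ENNReal.ofReal (1 / 2) * φ (A.next s true) +
      ENNReal.ofReal (1 / 2) * φ (A.next s false)
  | .ret _ => φ s

/-- The event that the configuration after `t` steps is `c`. -/
def fiber {Ω : Type*} (A : CoinAlgorithm) (X U : ℕ → Ω → Bool) (t : ℕ) (c : A.Config) : Set Ω :=
  {ω | A.run (fun i => X i ω) (fun i => U i ω) t = c}

/-- The requests made before the configuration `c` is reached. -/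
def requests (c : A.Config) : Finset (ℕ ⊕ ℕ) :=
  (Finset.range c.trials).disjSum (Finset.range c.flips)

/-- By `run_congr` the fiber is saturated for the map to the finitely many requested coins, so it is
the preimage of its own image. Measurability and independence both follow from this. -/
theorem exists_fiber_eq_preimage {Ω : Type*} (X U : ℕ → Ω → Bool) (t : ℕ) (c : A.Config) :
    ∃ B : Set (requests c → Bool),
      A.fiber X U t c = (fun ω (i : requests c) => (Sum.elim X U i : Ω → Bool) ω) ⁻¹' B := by
  refine ⟨{z | ∃ ω ∈ A.fiber X U t c, ∀ i : requests c,
    (Sum.elim X U (i : ℕ ⊕ ℕ) : Ω → Bool) ω = z i}, ?_⟩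
  ext ω
  constructor
  · exact fun hω => ⟨ω, hω, fun _ => rfl⟩
  · rintro ⟨ω', hω', hz⟩
    have hc : A.run (fun i => X i ω') (fun i => U i ω') t = c := hω'
    change A.run _ _ t = c
    rw [← hc]
    apply run_congr
    · intro i hi
      rw [hc] at hi
      exact (hz ⟨Sum.inl i, by simpa [requests] using hi⟩).symm
    · intro i hi
      rw [hc] at hi
      exact (hz ⟨Sum.inr i, by simpa [requests] using hi⟩).symm

/-! ### Markov property of the run -/

section Source

variable {Ω : Type*} [MeasurableSpace Ω] {P : Measure Ω} {p : ℝ} {X U : ℕ → Ω → Bool}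

theorem measurable_source (h : IsCoinSource P p X U) (i : ℕ ⊕ ℕ) :
    Measurable (Sum.elim X U i : Ω → Bool) := by
  cases i
  · exact h.measurable_trial _
  · exact h.measurable_flip _

theorem measurableSet_fiber (h : IsCoinSource P p X U) (t : ℕ) (c : A.Config) :
    MeasurableSet (A.fiber X U t c) := by
  obtain ⟨B, hB⟩ := exists_fiber_eq_preimage (A := A) X U t c
  have hm : Measurable fun ω (i : requests c) => (Sum.elim X U (i : ℕ ⊕ ℕ) : Ω → Bool) ω :=
    measurable_pi_lambda _ fun i => measurable_source h i
  rw [hB]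
  exact hm .of_discrete

theorem measure_fiber_inter [IsProbabilityMeasure P] (h : IsCoinSource P p X U) (t : ℕ)
    (c : A.Config) {k : ℕ ⊕ ℕ} (hk : k ∉ requests c) (b : Bool) :
    P (A.fiber X U t c ∩ {ω | (Sum.elim X U k : Ω → Bool) ω = b}) =
      P (A.fiber X U t c) * P {ω | (Sum.elim X U k : Ω → Bool) ω = b} := by
  obtain ⟨B, hB⟩ := exists_fiber_eq_preimage (A := A) X U t c
  have hi := h.indep.indepFun_finset (requests c) {k} (by simpa using hk) (measurable_source h)
  have := hi.measure_inter_preimage_eq_mul B {z | z ⟨k, by simp⟩ = b} .of_discrete .of_discrete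
  rw [← hB] at this
  exact this

theorem prob_false [IsProbabilityMeasure P] {Z : Ω → Bool} (hZ : Measurable Z) {r : ℝ} (hr : 0 ≤ r)
    (h : P {ω | Z ω = true} = ENNReal.ofReal r) : P {ω | Z ω = false} = ENNReal.ofReal (1 - r) := by
  have : {ω | Z ω = false} = {ω | Z ω = true}ᶜ := by ext; simp
  have hm : MeasurableSet {ω | Z ω = true} := hZ (MeasurableSet.of_discrete (s := {true}))
  rw [this, prob_compl_eq_one_sub hm, h,
    ENNReal.ofReal_sub _ hr, ENNReal.ofReal_one]

/-- Integrating over a set a function of a bit that is independent of it. -/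
theorem setLIntegral_bit [IsProbabilityMeasure P] {E : Set Ω} {Z : Ω → Bool} (hZ : Measurable Z)
    {r : ℝ} (hr : 0 ≤ r) (hp : P {ω | Z ω = true} = ENNReal.ofReal r)
    (hind : ∀ b, P (E ∩ {ω | Z ω = b}) = P E * P {ω | Z ω = b}) (f : Bool → ℝ≥0∞) :
    ∫⁻ ω in E, f (Z ω) ∂P =
      P E * (ENNReal.ofReal r * f true + ENNReal.ofReal (1 - r) * f false) := by
  have hmap : ∀ b, (P.restrict E).map Z {b} = P E * P {ω | Z ω = b} := by
    intro b
    rw [Measure.map_apply hZ .of_discrete, Measure.restrict_apply (hZ .of_discrete), ← hind,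
      Set.inter_comm]
    rfl
  rw [← lintegral_map (μ := P.restrict E) (f := f) (.of_discrete) hZ, lintegral_fintype,
    Fintype.sum_bool, hmap, hmap, hp, prob_false hZ hr hp]
  ring

theorem lintegral_eq_tsum_fiber (h : IsCoinSource P p X U) (t : ℕ) (g : Ω → ℝ≥0∞) :
    ∫⁻ ω, g ω ∂P = ∑' c, ∫⁻ ω in A.fiber X U t c, g ω ∂P := by
  rw [← lintegral_iUnion (fun c => measurableSet_fiber h t c)]
  · have : ⋃ c, A.fiber X U t c = Set.univ := by
      ext ω
      simp [fiber]
    rw [this, Measure.restrict_univ]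
  · intro c d hcd
    refine Set.disjoint_left.2 fun ω hc hd => hcd ?_
    exact Eq.trans (Eq.symm hc) hd

/-- On each fiber the coin about to be requested has an index outside `requests c`, hence is
independent of the fiber; summing over the countably many configurations gives the Markov property.
-/
theorem lintegral_run_succ [IsProbabilityMeasure P] (h : IsCoinSource P p X U) (hp : 0 ≤ p) (t : ℕ)
    (φ : A.State → ℝ≥0∞) :
    ∫⁻ ω, φ (A.run (fun i => X i ω) (fun i => U i ω) (t + 1)).state ∂P =
      ∫⁻ ω, A.nextMean p φ (A.run (fun i => X i ω) (fun i => U i ω) t).state ∂P := by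
  rw [lintegral_eq_tsum_fiber (A := A) h t, lintegral_eq_tsum_fiber (A := A) h t]
  refine tsum_congr fun c => ?_
  have hm := measurableSet_fiber (A := A) h t c
  have hR : ∫⁻ ω in A.fiber X U t c,
      A.nextMean p φ (A.run (fun i => X i ω) (fun i => U i ω) t).state ∂P =
      P (A.fiber X U t c) * A.nextMean p φ c.state := by
    rw [setLIntegral_congr_fun (g := fun _ => A.nextMean p φ c.state) hm, setLIntegral_const,
      mul_comm]
    intro ω hω
    have hω' : A.run (fun i => X i ω) (fun i => U i ω) t = c := hω
    simp only [hω']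
  have hL : ∫⁻ ω in A.fiber X U t c,
      φ (A.run (fun i => X i ω) (fun i => U i ω) (t + 1)).state ∂P =
      ∫⁻ ω in A.fiber X U t c, φ (A.step (fun i => X i ω) (fun i => U i ω) c).state ∂P := by
    refine setLIntegral_congr_fun hm fun ω hω => ?_
    have hω' : A.run (fun i => X i ω) (fun i => U i ω) t = c := hω
    simp only [run_succ, hω']
  rw [hL, hR]
  unfold nextMean step
  rcases hact : A.action c.state with _ | _ | b
  · exact setLIntegral_bit (h.measurable_trial _) hp (h.prob_trial _)
      (fun b => measure_fiber_inter h t c (k := Sum.inl c.trials) (by simp [requests]) b)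
      (fun b => φ (A.next c.state b))
  · have := setLIntegral_bit (h.measurable_flip c.flips) (by norm_num) (h.prob_flip _)
      (fun b => measure_fiber_inter h t c (k := Sum.inr c.flips) (by simp [requests]) b)
      (fun b => φ (A.next c.state b))
    rw [show (1 : ℝ) - 1 / 2 = 1 / 2 by norm_num] at this
    exact this
  · simp [mul_comm]

/-! ### Supermartingale bounds -/

/-- `1` at the states where the algorithm still runs, `0` at those where it has halted. -/
def active (A : CoinAlgorithm) (s : A.State) : ℝ≥0∞ :=
  match A.action s with
  | .ret _ => 0
  | _ => 1

theorem invariant_run {Inv : A.State → Prop} (hinit : Inv A.init)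
    (hnext : ∀ s, Inv s → (∀ b, A.action s ≠ .ret b) → ∀ b, Inv (A.next s b)) (x u : ℕ → Bool)
    (t : ℕ) : Inv (A.run x u t).state := by
  induction t with
  | zero => exact hinit
  | succ t ih =>
    rw [run_succ]
    generalize A.run x u t = c at *
    unfold step
    split
    · exact hnext _ ih (by simp [*]) _
    · exact hnext _ ih (by simp [*]) _
    · exact ih

theorem action_run_add {x u : ℕ → Bool} {t : ℕ} {b : Bool}
    (h : A.action (A.run x u t).state = .ret b) (k : ℕ) :
    A.run x u (t + k) = A.run x u t := by
  induction k with
  | zero => rfl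
  | succ k ih => rw [← add_assoc, run_succ, ih, step, h]

theorem trials_run_le (x u : ℕ → Bool) (t : ℕ) :
    ((A.run x u t).trials : ℝ≥0∞) ≤ ∑ s ∈ Finset.range t, A.active (A.run x u s).state := by
  induction t with
  | zero => simp [run]
  | succ t ih =>
    rw [Finset.sum_range_succ, run_succ]
    unfold step active
    rcases A.action (A.run x u t).state with _ | _ | b
    · push_cast
      gcongr
      exact ih
    · exact ih.trans le_self_add
    · exact ih.trans le_self_add

theorem numTrials_le (x u : ℕ → Bool) :
    (A.numTrials x u : ℝ≥0∞) ≤ ∑' s, A.active (A.run x u s).state := by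
  unfold numTrials
  rw [ENat.toENNReal_iSup]
  refine iSup_le fun t => ?_
  simpa using (trials_run_le x u t).trans (ENNReal.sum_le_tsum _)

theorem measurable_run (h : IsCoinSource P p X U) (t : ℕ) (φ : A.State → ℝ≥0∞) :
    Measurable fun ω => φ (A.run (fun i => X i ω) (fun i => U i ω) t).state := by
  intro B _
  have : (fun ω => φ (A.run (fun i => X i ω) (fun i => U i ω) t).state) ⁻¹' B =
      ⋃ c ∈ {c : A.Config | φ c.state ∈ B}, A.fiber X U t c := by
    ext ω
    simp [fiber]
  rw [this]
  exact MeasurableSet.biUnion (Set.to_countable _) fun c _ => measurableSet_fiber h t c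

/-- A supermartingale with running cost `κ`: with `κ = 0` it bounds return probabilities, with `κ =
A.active` the expected running time. -/
theorem lintegral_run_add_sum_le [IsProbabilityMeasure P] (h : IsCoinSource P p X U) (hp : 0 ≤ p)
    {Inv : A.State → Prop} (hinit : Inv A.init)
    (hnext : ∀ s, Inv s → (∀ b, A.action s ≠ .ret b) → ∀ b, Inv (A.next s b))
    {φ κ : A.State → ℝ≥0∞} (hφ : ∀ s, Inv s → A.nextMean p φ s + κ s ≤ φ s) (t : ℕ) :
    ∫⁻ ω, φ (A.run (fun i => X i ω) (fun i => U i ω) t).state ∂P +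
      ∑ s ∈ Finset.range t, ∫⁻ ω, κ (A.run (fun i => X i ω) (fun i => U i ω) s).state ∂P ≤
      φ A.init := by
  induction t with
  | zero => simp [run]
  | succ t ih =>
    refine le_trans ?_ ih
    rw [Finset.sum_range_succ, lintegral_run_succ h hp, add_comm (Finset.sum _ _), ← add_assoc,
      ← lintegral_add_left (measurable_run h t _)]
    gcongr
    exact hφ _ (invariant_run hinit hnext _ _ _)

theorem measure_returns_le [IsProbabilityMeasure P] (h : IsCoinSource P p X U) (hp : 0 ≤ p)
    {Inv : A.State → Prop} (hinit : Inv A.init)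
    (hnext : ∀ s, Inv s → (∀ b, A.action s ≠ .ret b) → ∀ b, Inv (A.next s b))
    {φ : A.State → ℝ≥0∞} (hφ : ∀ s, Inv s → A.nextMean p φ s ≤ φ s) (b : Bool)
    (hb : ∀ s, Inv s → A.action s = .ret b → 1 ≤ φ s) :
    P {ω | A.Returns (fun i => X i ω) (fun i => U i ω) b} ≤ φ A.init := by
  set E : ℕ → Set Ω := fun t =>
    {ω | A.action (A.run (fun i => X i ω) (fun i => U i ω) t).state = .ret b}
  have hE : {ω | A.Returns (fun i => X i ω) (fun i => U i ω) b} = ⋃ t, E t := by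
    ext ω
    simp [E, Returns]
  have hmono : Monotone E := by
    intro s t hst ω hω
    obtain ⟨k, rfl⟩ := Nat.exists_eq_add_of_le hst
    change A.action _ = _
    rw [action_run_add hω k]
    exact hω
  rw [hE, hmono.measure_iUnion]
  refine iSup_le fun t => ?_
  have h1 : P (E t) ≤ ∫⁻ ω, φ (A.run (fun i => X i ω) (fun i => U i ω) t).state ∂P := by
    -- Markov's inequality at threshold `1`.
    refine le_trans (measure_mono fun ω hω => ?_) (meas_ge_le_lintegral_div
      (measurable_run h t φ).aemeasurable one_ne_zero ENNReal.one_ne_top) |>.trans_eq (div_one _)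
    exact hb _ (invariant_run hinit hnext _ _ _) hω
  refine h1.trans (le_trans le_self_add
    (lintegral_run_add_sum_le (κ := fun _ => 0) h hp hinit hnext ?_ t))
  simpa using hφ

theorem lintegral_tsum_active_le [IsProbabilityMeasure P] (h : IsCoinSource P p X U) (hp : 0 ≤ p)
    {Inv : A.State → Prop} (hinit : Inv A.init)
    (hnext : ∀ s, Inv s → (∀ b, A.action s ≠ .ret b) → ∀ b, Inv (A.next s b))
    {φ : A.State → ℝ≥0∞} (hφ : ∀ s, Inv s → A.nextMean p φ s + A.active s ≤ φ s) :
    ∫⁻ ω, ∑' t, A.active (A.run (fun i => X i ω) (fun i => U i ω) t).state ∂P ≤ φ A.init := by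
  rw [lintegral_tsum fun t => (measurable_run h t _).aemeasurable, ENNReal.tsum_eq_iSup_nat]
  exact iSup_le fun t => le_trans le_add_self (lintegral_run_add_sum_le h hp hinit hnext hφ t)

theorem active_of_not_returns {x u : ℕ → Bool} (h : ∀ b, ¬ A.Returns x u b) (t : ℕ) :
    A.active (A.run x u t).state = 1 := by
  unfold active
  split
  next b hb => exact absurd ⟨t, hb⟩ (h b)
  · rfl

/-- A criterion for an algorithm to return `true` with a given probability and to perform a bounded
expected number of trials: a harmonic function `V` that extends the returned bit, and a bound `W`
for the expected number of steps that remain. -/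
theorem distribution_of_harmonic [IsProbabilityMeasure P] (h : IsCoinSource P p X U) (hp : 0 ≤ p)
    (hp1 : p ≤ 1) {Inv : A.State → Prop} (hinit : Inv A.init)
    (hnext : ∀ s, Inv s → (∀ b, A.action s ≠ .ret b) → ∀ b, Inv (A.next s b))
    {V W : A.State → ℝ} (hV0 : ∀ s, Inv s → 0 ≤ V s) (hV1 : ∀ s, Inv s → V s ≤ 1)
    (hW0 : ∀ s, Inv s → 0 ≤ W s)
    (hVret : ∀ s, Inv s → ∀ b, A.action s = .ret b → V s = if b then 1 else 0)
    (hVtrial : ∀ s, Inv s → A.action s = .trial →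
      V s = p * V (A.next s true) + (1 - p) * V (A.next s false))
    (hVflip : ∀ s, Inv s → A.action s = .flip →
      V s = 1 / 2 * V (A.next s true) + 1 / 2 * V (A.next s false))
    (hWtrial : ∀ s, Inv s → A.action s = .trial →
      p * W (A.next s true) + (1 - p) * W (A.next s false) + 1 ≤ W s)
    (hWflip : ∀ s, Inv s → A.action s = .flip →
      1 / 2 * W (A.next s true) + 1 / 2 * W (A.next s false) + 1 ≤ W s) :
    P {ω | A.Returns (fun i => X i ω) (fun i => U i ω) true} = ENNReal.ofReal (V A.init) ∧
    P {ω | A.Returns (fun i => X i ω) (fun i => U i ω) false} = ENNReal.ofReal (1 - V A.init) ∧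
    ∫⁻ ω, (A.numTrials (fun i => X i ω) (fun i => U i ω) : ℝ≥0∞) ∂P ≤ ENNReal.ofReal (W A.init) := by
  have mean : ∀ (F : A.State → ℝ) (s : A.State), Inv s → (∀ s, Inv s → 0 ≤ F s) →
      (A.action s = .trial → A.nextMean p (fun s => ENNReal.ofReal (F s)) s =
        ENNReal.ofReal (p * F (A.next s true) + (1 - p) * F (A.next s false))) ∧
      (A.action s = .flip → A.nextMean p (fun s => ENNReal.ofReal (F s)) s =
        ENNReal.ofReal (1 / 2 * F (A.next s true) + 1 / 2 * F (A.next s false))) := by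
    intro F s hs hF
    constructor
    · intro ha
      have hn := fun b => hF _ (hnext s hs (by simp [ha]) b)
      rw [ENNReal.ofReal_add (mul_nonneg hp (hn _)) (mul_nonneg (by linarith) (hn _)),
        ENNReal.ofReal_mul hp, ENNReal.ofReal_mul (by linarith)]
      simp [nextMean, ha]
    · intro ha
      have hn := fun b => hF _ (hnext s hs (by simp [ha]) b)
      rw [ENNReal.ofReal_add (mul_nonneg (by norm_num) (hn _)) (mul_nonneg (by norm_num) (hn _)),
        ENNReal.ofReal_mul (by norm_num), ENNReal.ofReal_mul (by norm_num)]
      simp [nextMean, ha]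
  have hT : P {ω | A.Returns (fun i => X i ω) (fun i => U i ω) true} ≤
      ENNReal.ofReal (V A.init) := by
    refine measure_returns_le (φ := fun s => ENNReal.ofReal (V s)) h hp hinit hnext ?_ true ?_
    · intro s hs
      rcases ha : A.action s with _ | _ | b
      · rw [(mean V s hs hV0).1 ha, ← hVtrial s hs ha]
      · rw [(mean V s hs hV0).2 ha, ← hVflip s hs ha]
      · simp [nextMean, ha]
    · intro s hs ha
      simp [hVret s hs _ ha]
  have hF : P {ω | A.Returns (fun i => X i ω) (fun i => U i ω) false} ≤
      ENNReal.ofReal (1 - V A.init) := by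
    have hV0' : ∀ s, Inv s → 0 ≤ 1 - V s := fun s hs => by linarith [hV1 s hs]
    refine measure_returns_le (φ := fun s => ENNReal.ofReal (1 - V s)) h hp hinit hnext ?_ false ?_
    · intro s hs
      rcases ha : A.action s with _ | _ | b
      · rw [(mean (fun s => 1 - V s) s hs hV0').1 ha, hVtrial s hs ha]
        exact le_of_eq (congrArg _ (by ring))
      · rw [(mean (fun s => 1 - V s) s hs hV0').2 ha, hVflip s hs ha]
        exact le_of_eq (congrArg _ (by ring))
      · simp [nextMean, ha]
    · intro s hs ha
      simp [hVret s hs _ ha]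
  have hW : ∫⁻ ω, ∑' t, A.active (A.run (fun i => X i ω) (fun i => U i ω) t).state ∂P ≤
      ENNReal.ofReal (W A.init) := by
    refine lintegral_tsum_active_le (φ := fun s => ENNReal.ofReal (W s)) h hp hinit hnext ?_
    intro s hs
    rcases ha : A.action s with _ | _ | b
    · have hn := fun b => hW0 _ (hnext s hs (by simp [ha]) b)
      have h0 : 0 ≤ p * W (A.next s true) + (1 - p) * W (A.next s false) :=
        add_nonneg (mul_nonneg hp (hn _)) (mul_nonneg (by linarith) (hn _))
      have hact : A.active s = ENNReal.ofReal 1 := by simp [active, ha]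
      rw [(mean W s hs hW0).1 ha, hact, ← ENNReal.ofReal_add h0 zero_le_one]
      exact ENNReal.ofReal_le_ofReal (hWtrial s hs ha)
    · have hn := fun b => hW0 _ (hnext s hs (by simp [ha]) b)
      have h0 : 0 ≤ 1 / 2 * W (A.next s true) + 1 / 2 * W (A.next s false) :=
        add_nonneg (mul_nonneg (by norm_num) (hn _)) (mul_nonneg (by norm_num) (hn _))
      have hact : A.active s = ENNReal.ofReal 1 := by simp [active, ha]
      rw [(mean W s hs hW0).2 ha, hact, ← ENNReal.ofReal_add h0 zero_le_one]
      exact ENNReal.ofReal_le_ofReal (hWflip s hs ha)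
    · simp [nextMean, active, ha]
  have hhalt : ∀ᵐ ω ∂P, A.Returns (fun i => X i ω) (fun i => U i ω) true ∨
      A.Returns (fun i => X i ω) (fun i => U i ω) false := by
    have hm : Measurable fun ω =>
        ∑' t, A.active (A.run (fun i => X i ω) (fun i => U i ω) t).state :=
      Measurable.tsum fun t => measurable_run h t _
    -- A run that never halts makes every term of the sum equal to `1`, while the sum has finite
    -- mean.
    filter_upwards [ae_lt_top hm (ne_top_of_le_ne_top ENNReal.ofReal_ne_top hW)] with ω hω
    by_contra hcon
    push Not at hcon
    have h1 := active_of_not_returns (A := A) (x := fun i => X i ω) (u := fun i => U i ω)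
      (by rintro (_ | _); exacts [hcon.2, hcon.1])
    simp [h1] at hω
  have hone : 1 ≤ P {ω | A.Returns (fun i => X i ω) (fun i => U i ω) true} +
      P {ω | A.Returns (fun i => X i ω) (fun i => U i ω) false} := by
    refine le_trans ?_ (measure_union_le _ _)
    have huniv := measure_congr (Filter.eventuallyEq_univ.2 hhalt)
    rw [measure_univ] at huniv
    exact huniv.ge
  -- The upper bounds `hT` and `hF` add up to `1` and the two probabilities to at least `1`, so both
  -- bounds are equalities; no limit theorem for martingales is needed.
  have hsum : ENNReal.ofReal (V A.init) + ENNReal.ofReal (1 - V A.init) = 1 := by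
    rw [← ENNReal.ofReal_add (hV0 _ hinit) (by linarith [hV1 _ hinit])]
    simp
  refine ⟨le_antisymm hT ?_, le_antisymm hF ?_, ?_⟩
  · refine ENNReal.le_of_add_le_add_right (a := ENNReal.ofReal (1 - V A.init))
      ENNReal.ofReal_ne_top ?_
    rw [hsum]
    exact hone.trans (by gcongr)
  · refine ENNReal.le_of_add_le_add_left (a := ENNReal.ofReal (V A.init))
      ENNReal.ofReal_ne_top ?_
    rw [hsum]
    exact hone.trans (by gcongr)
  · exact le_trans (lintegral_mono fun ω => numTrials_le _ _) hW

end Source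

end CoinAlgorithm

/-! ### An algorithm that returns `true` with probability `1 / (2 * p)`

A site `(N, n)` with `n ≤ N` stands for the task of returning `true` with probability
`((1 - p) / (p * up N)) ^ n`, where `up N = 3 * (N + 2) / (4 * N)`. A trial that comes out `false`
moves it to `(N, n - 1)`; one that comes out `true` moves it to `(N, n + 1)` with probability
`up N`. At `(N, N + 1)` the algorithm gives up with the probability that turns the task into that
of the site `(N + 1, N + 1)`. The sites `(N + 1, 0)` and `(0, n)` stand for success and failure. -/

namespace ReciprocalHalf

/-- The states: `((a, b), (s, s'))` with `b ≠ 0` stands for the choice between the sites `s` and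
`s'`, to be made by fair coin flips, with probabilities `a / b` and `1 - a / b`. If `b = 0`, then
the current site is `s`. -/
abbrev State : Type := (ℕ × ℕ) × ((ℕ × ℕ) × (ℕ × ℕ))

/-- The state in which the algorithm arrives at a site. -/
def enter (s : ℕ × ℕ) : State :=
  if s.1 < s.2 then
    (((s.1 * (s.1 + 3)) ^ s.2, ((s.1 + 1) * (s.1 + 2)) ^ s.2), ((s.1 + 1, s.2), (0, 0)))
  else ((0, 0), (s, s))

/-- The action in a state. -/
def action (σ : State) : CoinAction :=
  if σ.1.2 = 0 then
    if σ.2.1.1 = 0 then .ret false else if σ.2.1.2 = 0 then .ret true else .trial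
  else .flip

/-- The next state after a fair coin flip with outcome `x`, in a choice between two sites: this
reads off the binary expansion of `a / b`. -/
def afterFlip (σ : State) (x : Bool) : State :=
  if σ.1.2 ≤ 2 * σ.1.1 then
    if x = true then enter σ.2.1 else ((2 * σ.1.1 - σ.1.2, σ.1.2), σ.2)
  else if x = true then enter σ.2.2 else ((2 * σ.1.1, σ.1.2), σ.2)

/-- The next state after a trial with outcome `x` at the site `s`. -/
def afterTrial (s : ℕ × ℕ) (x : Bool) : State :=
  if x = true then ((3 * (s.1 + 2), 4 * s.1), ((s.1, s.2 + 1), s)) else enter (s.1, s.2 - 1)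

/-- The next state. -/
def next (σ : State) (x : Bool) : State :=
  if σ.1.2 = 0 then afterTrial σ.2.1 x else afterFlip σ x

section Computability

open Primrec

theorem primrec_enter : Primrec enter := by
  have pow : Primrec₂ ((· ^ ·) : ℕ → ℕ → ℕ) := Primrec₂.unpaired'.1 Nat.Primrec.pow
  have c : ∀ k : ℕ, Primrec fun _ : ℕ × ℕ => k := fun k => Primrec.const k
  have add : ∀ k : ℕ, Primrec fun s : ℕ × ℕ => s.1 + k := fun k => nat_add.comp fst (c k)
  exact Primrec.ite (nat_lt.comp fst snd)
    (((pow.comp (nat_mul.comp fst (add 3)) snd).pair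
      (pow.comp (nat_mul.comp (add 1) (add 2)) snd)).pair
      (((add 1).pair snd).pair (Primrec.const (0, 0))))
    ((Primrec.const (0, 0)).pair (Primrec.id.pair Primrec.id))

theorem primrec_action : Primrec action :=
  Primrec.ite (Primrec.eq.comp (snd.comp fst) (Primrec.const 0))
    (Primrec.ite (Primrec.eq.comp (fst.comp (fst.comp snd)) (Primrec.const 0)) (Primrec.const _)
      (Primrec.ite (Primrec.eq.comp (snd.comp (fst.comp snd)) (Primrec.const 0))
        (Primrec.const _) (Primrec.const _)))
    (Primrec.const _)

theorem primrec_afterFlip : Primrec₂ afterFlip := by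
  have a : Primrec fun y : State × Bool => 2 * y.1.1.1 :=
    nat_mul.comp (Primrec.const 2) (fst.comp (fst.comp fst))
  have b : Primrec fun y : State × Bool => y.1.1.2 := snd.comp (fst.comp fst)
  have s : Primrec fun y : State × Bool => y.1.2 := snd.comp fst
  have x : PrimrecPred fun y : State × Bool => y.2 = true :=
    Primrec.eq.comp snd (Primrec.const true)
  exact Primrec.ite (nat_le.comp b a)
    (Primrec.ite x (primrec_enter.comp (fst.comp s)) (((nat_sub.comp a b).pair b).pair s))
    (Primrec.ite x (primrec_enter.comp (snd.comp s)) ((a.pair b).pair s))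

theorem primrec_afterTrial : Primrec₂ afterTrial := by
  have s : Primrec fun y : (ℕ × ℕ) × Bool => y.1 := fst
  have N : Primrec fun y : (ℕ × ℕ) × Bool => y.1.1 := fst.comp s
  have n : Primrec fun y : (ℕ × ℕ) × Bool => y.1.2 := snd.comp s
  exact Primrec.ite (Primrec.eq.comp snd (Primrec.const true))
    (((nat_mul.comp (Primrec.const 3) (nat_add.comp N (Primrec.const 2))).pair
      (nat_mul.comp (Primrec.const 4) N)).pair
      ((N.pair (nat_add.comp n (Primrec.const 1))).pair s))
    (primrec_enter.comp (N.pair (nat_sub.comp n (Primrec.const 1))))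

theorem primrec_next : Primrec₂ next :=
  Primrec.ite (Primrec.eq.comp (snd.comp (fst.comp fst)) (Primrec.const 0))
    (primrec_afterTrial.comp (fst.comp (snd.comp fst)) snd) primrec_afterFlip

end Computability

/-- The algorithm. It starts with a choice between success and the site `(6, 1)`, whose task has
success probability `(1 - p) / p`. -/
def algorithm : CoinAlgorithm where
  State := State
  init := ((1, 2), ((6, 0), (6, 1)))
  action := action
  next := next
  computable_action := primrec_action.to_comp
  computable_next := primrec_next.to_comp

/-! ### Invariant of the states -/

/-- The sites that can occur. -/
def SiteInv (s : ℕ × ℕ) : Prop := s = (0, 0) ∨ 6 ≤ s.1 ∧ s.2 ≤ s.1 + 1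

/-- The states that can occur. -/
def Inv (σ : State) : Prop :=
  SiteInv σ.2.1 ∧ SiteInv σ.2.2 ∧ σ.1.1 ≤ σ.1.2 ∧ (σ.1.2 = 0 → σ.2.1.2 ≤ σ.2.1.1)

theorem inv_enter {s : ℕ × ℕ} (hs : SiteInv s) : Inv (enter s) := by
  unfold enter
  split_ifs with h
  · have hN : 6 ≤ s.1 ∧ s.2 ≤ s.1 + 1 := hs.resolve_left (by rintro rfl; simp at h)
    refine ⟨Or.inr ⟨by grind, by grind⟩, Or.inl rfl, Nat.pow_le_pow_left (by lia) _, ?_⟩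
    intro h0
    exact absurd h0 (by positivity)
  · exact ⟨hs, hs, le_rfl, fun _ => not_lt.1 h⟩

theorem inv_afterFlip {σ : State} (hσ : Inv σ) (hb : σ.1.2 ≠ 0) (x : Bool) :
    Inv (afterFlip σ x) := by
  obtain ⟨h1, h2, hab, -⟩ := hσ
  unfold afterFlip
  split_ifs with h hx hx
  · exact inv_enter h1
  · exact ⟨h1, h2, by grind, fun h0 => absurd h0 hb⟩
  · exact inv_enter h2
  · exact ⟨h1, h2, by grind, fun h0 => absurd h0 hb⟩

theorem inv_afterTrial {s : ℕ × ℕ} (hs : 6 ≤ s.1) (hn : s.2 ≤ s.1) (x : Bool) :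
    Inv (afterTrial s x) := by
  unfold afterTrial
  split_ifs
  -- The acceptance probability is at most `1` because `3 * (N + 2) ≤ 4 * N` exactly when `6 ≤ N`.
  · exact ⟨Or.inr ⟨hs, by grind⟩, Or.inr ⟨hs, by grind⟩, by grind, by grind⟩
  · exact inv_enter (Or.inr ⟨hs, by grind⟩)

theorem action_eq_trial {σ : State} (h : action σ = .trial) :
    σ.1.2 = 0 ∧ σ.2.1.1 ≠ 0 ∧ σ.2.1.2 ≠ 0 := by
  unfold action at h
  split_ifs at h with h1 h2 h3
  exact ⟨h1, h2, h3⟩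

theorem action_eq_flip {σ : State} (h : action σ = .flip) : σ.1.2 ≠ 0 := by
  unfold action at h
  split_ifs at h with h1
  exact h1

theorem Inv.six_le {σ : State} (hσ : Inv σ) (h : action σ = .trial) :
    6 ≤ σ.2.1.1 ∧ σ.2.1.2 ≤ σ.2.1.1 := by
  obtain ⟨h1, h2, h3⟩ := action_eq_trial h
  exact ⟨(hσ.1.resolve_left fun h0 => h2 (by rw [h0])).1, hσ.2.2.2 h1⟩

theorem inv_next {σ : State} (hσ : Inv σ) (h : ∀ b, action σ ≠ .ret b) (x : Bool) :
    Inv (next σ x) := by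
  unfold next
  rcases ha : action σ with _ | _ | b
  · rw [if_pos (action_eq_trial ha).1]
    exact inv_afterTrial (hσ.six_le ha).1 (hσ.six_le ha).2 x
  · rw [if_neg (action_eq_flip ha)]
    exact inv_afterFlip hσ (action_eq_flip ha) x
  · exact absurd ha (h b)

/-! ### Harmonic function and potential -/

/-- The mean of a function of the sites in a state, plus a constant for each pending choice. -/
noncomputable def stateMean (F : ℕ × ℕ → ℝ) (k : ℝ) (σ : State) : ℝ :=
  if σ.1.2 = 0 then F σ.2.1
  else (σ.1.1 / σ.1.2 : ℝ) * F σ.2.1 + (1 - σ.1.1 / σ.1.2 : ℝ) * F σ.2.2 + k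

/-- A choice takes two flips on average, so `k = 2` pays `k / 2 = 1` per flip. The last summand on
the left is the change caused by entering the chosen site, which may open a new choice. -/
theorem stateMean_afterFlip {F : ℕ × ℕ → ℝ} {k : ℝ} {σ : State} (hb : σ.1.2 ≠ 0) :
    1 / 2 * stateMean F k (afterFlip σ true) + 1 / 2 * stateMean F k (afterFlip σ false) + k / 2 +
      1 / 2 * (F (if σ.1.2 ≤ 2 * σ.1.1 then σ.2.1 else σ.2.2) -
        stateMean F k (enter (if σ.1.2 ≤ 2 * σ.1.1 then σ.2.1 else σ.2.2))) = stateMean F k σ := by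
  have hb' : (σ.1.2 : ℝ) ≠ 0 := Nat.cast_ne_zero.2 hb
  by_cases h : σ.1.2 ≤ 2 * σ.1.1
  · simp only [afterFlip, if_pos h, if_true, Bool.false_eq_true, if_false]
    simp only [stateMean, if_neg hb]
    push_cast [Nat.cast_sub h]
    field_simp
    ring
  · simp only [afterFlip, if_neg h, if_true, Bool.false_eq_true, if_false]
    simp only [stateMean, if_neg hb]
    push_cast
    field_simp
    ring

/-- The success probability at a site, with `r = (1 - p) / p`. -/
noncomputable def siteValue (r : ℝ) (s : ℕ × ℕ) : ℝ :=
  if s.1 = 0 then 0 else (r * (4 * s.1) / (3 * (s.1 + 2))) ^ s.2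

/-- A bound for the expected number of steps that remain at a site. -/
noncomputable def siteBound (s : ℕ × ℕ) : ℝ :=
  if s.1 = 0 ∨ s.2 = 0 then 0 else 20 * (4 * s.1 - s.2)

theorem siteValue_nonneg {r : ℝ} (hr : 0 ≤ r) (s : ℕ × ℕ) : 0 ≤ siteValue r s := by
  unfold siteValue
  split_ifs <;> positivity

theorem siteValue_le_one {r : ℝ} (hr : 0 ≤ r) (hr' : r ≤ 1 / 2) (s : ℕ × ℕ) :
    siteValue r s ≤ 1 := by
  unfold siteValue
  split_ifs
  · exact zero_le_one
  · refine pow_le_one₀ (by positivity) ?_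
    rw [div_le_one (by positivity)]
    nlinarith [(Nat.cast_nonneg s.1 : (0 : ℝ) ≤ s.1)]

theorem siteBound_nonneg {s : ℕ × ℕ} (hs : SiteInv s) : 0 ≤ siteBound s := by
  unfold siteBound
  split_ifs with h
  · exact le_rfl
  · obtain ⟨h6, hn⟩ := hs.resolve_left (by rintro rfl; simp at h)
    have h6' : (6 : ℝ) ≤ s.1 := by exact_mod_cast h6
    have hn' : (s.2 : ℝ) ≤ s.1 + 1 := by exact_mod_cast hn
    linarith

theorem stateMean_enter_siteValue {r : ℝ} {s : ℕ × ℕ} (hs : SiteInv s) :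
    stateMean (siteValue r) 0 (enter s) = siteValue r s := by
  unfold enter
  split_ifs with h
  · obtain ⟨h6, -⟩ := hs.resolve_left (by rintro rfl; simp at h)
    have h6' : (6 : ℝ) ≤ s.1 := by exact_mod_cast h6
    have h0 : s.1 ≠ 0 := by lia
    have hb : ((s.1 + 1) * (s.1 + 2)) ^ s.2 ≠ 0 := by positivity
    simp only [stateMean, siteValue, if_neg hb, if_neg h0, if_neg (Nat.succ_ne_zero s.1), if_true]
    push_cast
    rw [← div_pow, mul_zero, add_zero, add_zero, ← mul_pow]
    congr 1
    field_simp
    ring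
  · simp [stateMean]

/-- Bernoulli's inequality for the reciprocal, whose base is $1+2/(N(N+3))$. -/
theorem pow_ratio_le (N : ℕ) (hN : 0 < N) :
    ((N * (N + 3) : ℝ) ^ (N + 1) / ((N + 1) * (N + 2)) ^ (N + 1)) ≤ (N + 2) / (N + 4) := by
  have hN' : (0 : ℝ) < N := Nat.cast_pos.2 hN
  have h1 : 1 + ((N + 1 : ℕ) : ℝ) * (2 / (N * (N + 3))) ≤ (1 + 2 / (N * (N + 3) : ℝ)) ^ (N + 1) :=
    one_add_mul_le_pow (by
      have : (0 : ℝ) ≤ 2 / (N * (N + 3)) := by positivity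
      linarith) _
  have h2 : (1 + 2 / (N * (N + 3) : ℝ)) = ((N + 1) * (N + 2)) / (N * (N + 3)) := by
    field_simp
    ring
  have h3 : (N + 4 : ℝ) / (N + 2) ≤ 1 + ((N + 1 : ℕ) : ℝ) * (2 / (N * (N + 3))) := by
    push_cast
    rw [← sub_nonneg]
    have : 1 + (N + 1 : ℝ) * (2 / (N * (N + 3))) - (N + 4) / (N + 2) =
        4 / (N * (N + 3) * (N + 2)) := by
      field_simp
      ring
    rw [this]
    positivity
  rw [h2, div_pow] at h1
  have h4 := inv_anti₀ (by positivity) (h3.trans h1)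
  rwa [inv_div, inv_div] at h4

theorem stateMean_enter_siteBound {s : ℕ × ℕ} (hs : SiteInv s) :
    stateMean siteBound 2 (enter s) ≤ siteBound s := by
  unfold enter
  split_ifs with h
  · obtain ⟨h6, hn⟩ := hs.resolve_left (by rintro rfl; simp at h)
    obtain ⟨N, n⟩ := s
    obtain rfl : n = N + 1 := le_antisymm hn h
    have h6' : (6 : ℝ) ≤ N := by exact_mod_cast h6
    have h0 : N ≠ 0 := by rintro rfl; simp at h6
    have hb : ((N + 1) * (N + 2)) ^ (N + 1) ≠ 0 := by positivity
    have hr := pow_ratio_le N (by lia)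
    simp only [stateMean, siteBound, if_neg hb]
    simp only [h0, Nat.succ_ne_zero, or_self, if_false, if_true]
    push_cast
    -- The values are `60 * (N + 1)` at the site `(N + 1, N + 1)` and `20 * (3 * N - 1)` at `(N, N +
    -- 1)`. The inequality amounts to $82(N+4)\le 120(N+1)$, which fails for $N=5$.
    have h1 : (N + 2 : ℝ) / (N + 4) * (60 * (N + 1)) + 2 ≤ 20 * (4 * N - (N + 1)) := by
      rw [div_mul_eq_mul_div, ← le_sub_iff_add_le, div_le_iff₀ (by linarith)]
      nlinarith
    have h2 := mul_le_mul_of_nonneg_right hr (by positivity : (0 : ℝ) ≤ 60 * (N + 1))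
    linarith
  · simp [stateMean]

theorem stateMean_nonneg {F : ℕ × ℕ → ℝ} {k : ℝ} (hk : 0 ≤ k) (hF : ∀ s, SiteInv s → 0 ≤ F s)
    {σ : State} (hσ : Inv σ) : 0 ≤ stateMean F k σ := by
  unfold stateMean
  split_ifs with h
  · exact hF _ hσ.1
  · have h1 : (σ.1.1 / σ.1.2 : ℝ) ≤ 1 :=
      div_le_one_of_le₀ (Nat.cast_le.2 hσ.2.2.1) (Nat.cast_nonneg _)
    have := mul_nonneg (sub_nonneg.2 h1) (hF _ hσ.2.1)
    have := mul_nonneg (by positivity : (0 : ℝ) ≤ σ.1.1 / σ.1.2) (hF _ hσ.1)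
    linarith

theorem stateMean_le_one {F : ℕ × ℕ → ℝ} (hF : ∀ s, F s ≤ 1) {σ : State} (hσ : Inv σ) :
    stateMean F 0 σ ≤ 1 := by
  have := stateMean_nonneg (F := fun s => 1 - F s) le_rfl (fun s _ => sub_nonneg.2 (hF s)) hσ
  unfold stateMean at *
  split_ifs at * <;> linarith

theorem siteValue_eq_trial {p : ℝ} (hp : 0 < p) {s : ℕ × ℕ} (hs : SiteInv s) (h6 : 6 ≤ s.1)
    (hn0 : s.2 ≠ 0) :
    siteValue ((1 - p) / p) s =
      p * stateMean (siteValue ((1 - p) / p)) 0 (afterTrial s true) +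
        (1 - p) * stateMean (siteValue ((1 - p) / p)) 0 (afterTrial s false) := by
  obtain ⟨N, n⟩ := s
  obtain ⟨n, rfl⟩ := Nat.exists_eq_succ_of_ne_zero hn0
  have h6' : (6 : ℝ) ≤ N := by exact_mod_cast h6
  have hN : N ≠ 0 := by rintro rfl; simp at h6
  have hb : 4 * N ≠ 0 := by lia
  have hs' : SiteInv (N, n) := Or.inr ⟨h6, by have := hs.resolve_left (by simp); grind⟩
  simp only [afterTrial, if_true, Bool.false_eq_true, if_false, Nat.succ_eq_add_one,
    Nat.add_sub_cancel]
  rw [stateMean_enter_siteValue hs']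
  simp only [stateMean, siteValue, if_neg hN, if_neg hb]
  push_cast
  have hx : (1 - p) / p * (4 * N) / (3 * (N + 2)) * (p * (3 * (N + 2))) = (1 - p) * (4 * N) := by
    field_simp
  generalize (1 - p) / p * (4 * N) / (3 * (N + 2)) = x at *
  rw [pow_succ, pow_succ]
  have hy : 1 - p = x * p * (3 * (N + 2)) / (4 * N) := by
    field_simp
    linarith
  have hq : 1 - p = x * (p * ((3 * (N + 2)) / (4 * N))) := by
    rw [hy]
    ring
  -- The harmonic equation factors as $x^n(x-1)(pux-(1-p))=0$ with $u$ the acceptance probability.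
  linear_combination (x ^ n * (x - 1)) * hq

theorem siteBound_trial {p : ℝ} (hp : 2 / 3 ≤ p) (hp1 : p ≤ 1) {s : ℕ × ℕ} (hs : SiteInv s)
    (h6 : 6 ≤ s.1) (hn0 : s.2 ≠ 0) :
    p * stateMean siteBound 2 (afterTrial s true) +
      (1 - p) * stateMean siteBound 2 (afterTrial s false) + 1 ≤ siteBound s := by
  obtain ⟨N, n⟩ := s
  obtain ⟨n, rfl⟩ := Nat.exists_eq_succ_of_ne_zero hn0
  have h6' : (6 : ℝ) ≤ N := by exact_mod_cast h6
  have hN : N ≠ 0 := by rintro rfl; simp at h6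
  have hb : 4 * N ≠ 0 := by lia
  have hnN := (hs.resolve_left (by simp)).2
  have hs' : SiteInv (N, n) := Or.inr ⟨h6, by grind⟩
  have hnN' : (n : ℝ) ≤ N := by exact_mod_cast (by grind : n ≤ N)
  have hlow : stateMean siteBound 2 (enter (N, n)) ≤ 20 * (4 * N - n) := by
    refine (stateMean_enter_siteBound hs').trans ?_
    unfold siteBound
    split_ifs
    · dsimp only at *
      linarith
    · exact le_rfl
  simp only [afterTrial, if_true, Bool.false_eq_true, if_false, Nat.succ_eq_add_one,
    Nat.add_sub_cancel]
  have h1 := mul_le_mul_of_nonneg_left hlow (sub_nonneg.2 hp1)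
  have hu : (3 / 4 : ℝ) ≤ 3 * (N + 2) / (4 * N) := by
    rw [le_div_iff₀ (by linarith)]
    linarith
  simp only [stateMean, siteBound, if_neg hb, hN, Nat.succ_ne_zero, or_self, if_false] at h1 ⊢
  push_cast at h1 ⊢
  generalize (3 * ((N : ℝ) + 2) / (4 * N)) = u at *
  -- With $u\ge 3/4$ the potential falls by at least $20(\frac34p-(1-p))=35p-20$ on average, which
  -- covers $1+2p$: the trial itself, and the choice that follows an outcome `true`.
  nlinarith

theorem stateMean_flip_siteValue {r : ℝ} {σ : State} (hσ : Inv σ) (hb : σ.1.2 ≠ 0) :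
    stateMean (siteValue r) 0 σ = 1 / 2 * stateMean (siteValue r) 0 (afterFlip σ true) +
      1 / 2 * stateMean (siteValue r) 0 (afterFlip σ false) := by
  have hs : SiteInv (if σ.1.2 ≤ 2 * σ.1.1 then σ.2.1 else σ.2.2) := by
    split_ifs
    exacts [hσ.1, hσ.2.1]
  have h1 := stateMean_afterFlip (F := siteValue r) (k := 0) hb
  rw [stateMean_enter_siteValue hs] at h1
  linarith

theorem stateMean_flip_siteBound {σ : State} (hσ : Inv σ) (hb : σ.1.2 ≠ 0) :
    1 / 2 * stateMean siteBound 2 (afterFlip σ true) +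
      1 / 2 * stateMean siteBound 2 (afterFlip σ false) + 1 ≤ stateMean siteBound 2 σ := by
  have hs : SiteInv (if σ.1.2 ≤ 2 * σ.1.1 then σ.2.1 else σ.2.2) := by
    split_ifs
    exacts [hσ.1, hσ.2.1]
  have h1 := stateMean_afterFlip (F := siteBound) (k := 2) hb
  have h2 := stateMean_enter_siteBound hs
  linarith

theorem algorithm_spec {p : ℝ} (hp : 2 / 3 ≤ p) (hp1 : p ≤ 1) {Ω : Type*} [MeasurableSpace Ω]
    {P : Measure Ω} [IsProbabilityMeasure P] {X U : ℕ → Ω → Bool} (h : IsCoinSource P p X U) :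
    P {ω | algorithm.Returns (fun i => X i ω) (fun i => U i ω) true} =
        ENNReal.ofReal (1 / (2 * p)) ∧
      P {ω | algorithm.Returns (fun i => X i ω) (fun i => U i ω) false} =
        ENNReal.ofReal (1 - 1 / (2 * p)) ∧
      ∫⁻ ω, (algorithm.numTrials (fun i => X i ω) (fun i => U i ω) : ℝ≥0∞) ∂P ≤
        ENNReal.ofReal (stateMean siteBound 2 algorithm.init) := by
  have hp0 : 0 < p := by linarith
  have hr : 0 ≤ (1 - p) / p := div_nonneg (by linarith) hp0.le
  have hr' : (1 - p) / p ≤ 1 / 2 := by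
    rw [div_le_iff₀ hp0]
    linarith
  have hinit : Inv algorithm.init :=
    ⟨Or.inr (by decide), Or.inr (by decide), by decide, by decide⟩
  -- The sites $(6,0)$ and $(6,1)$ have values $1$ and $r$.
  have hval : stateMean (siteValue ((1 - p) / p)) 0 algorithm.init = 1 / (2 * p) := by
    simp only [algorithm, stateMean, siteValue]
    norm_num
    field_simp
    ring
  have key := CoinAlgorithm.distribution_of_harmonic (A := algorithm) (Inv := Inv)
    (V := stateMean (siteValue ((1 - p) / p)) 0) (W := stateMean siteBound 2) h hp0.le hp1 hinit
    (fun s hs hact b => inv_next hs hact b)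
    (fun s hs => stateMean_nonneg le_rfl (fun s _ => siteValue_nonneg hr s) hs)
    (fun s hs => stateMean_le_one (siteValue_le_one hr hr') hs)
    (fun s hs => stateMean_nonneg zero_le_two (fun s hs => siteBound_nonneg hs) hs)
    ?_ ?_ ?_ ?_ ?_
  · rwa [hval] at key
  · intro σ hσ b hb
    have hb' : action σ = .ret b := hb
    unfold action at hb'
    split_ifs at hb' with h1 h2 h3 <;> cases hb' <;> simp [stateMean, siteValue, *]
  · intro σ hσ ha
    obtain ⟨h1, -, h3⟩ := action_eq_trial ha
    have := siteValue_eq_trial hp0 hσ.1 (hσ.six_le ha).1 h3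
    simp only [algorithm, next, if_pos h1]
    have e : stateMean (siteValue ((1 - p) / p)) 0 σ = siteValue ((1 - p) / p) σ.2.1 := if_pos h1
    rw [e]
    exact this
  · intro σ hσ ha
    have hb := action_eq_flip ha
    simp only [algorithm, next, if_neg hb]
    exact stateMean_flip_siteValue hσ hb
  · intro σ hσ ha
    obtain ⟨h1, -, h3⟩ := action_eq_trial ha
    have := siteBound_trial hp hp1 hσ.1 (hσ.six_le ha).1 h3
    simp only [algorithm, next, if_pos h1]
    have e : stateMean siteBound 2 σ = siteBound σ.2.1 := if_pos h1
    rw [e]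
    exact this
  · intro σ hσ ha
    have hb := action_eq_flip ha
    simp only [algorithm, next, if_neg hb]
    exact stateMean_flip_siteBound hσ hb

end ReciprocalHalf

theorem corollary3p2 :
    ∃ (A : CoinAlgorithm) (C : ℝ≥0), ∀ p : ℝ, 2 / 3 ≤ p → p ≤ 1 →
      ∀ (Ω : Type*) [MeasurableSpace Ω] (P : Measure Ω) [IsProbabilityMeasure P]
        (X U : ℕ → Ω → Bool), IsCoinSource P p X U →
        P {ω | A.Returns (fun i => X i ω) (fun i => U i ω) true} = ENNReal.ofReal (1 / (2 * p)) ∧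
        P {ω | A.Returns (fun i => X i ω) (fun i => U i ω) false} =
          ENNReal.ofReal (1 - 1 / (2 * p)) ∧
        ∫⁻ ω, (A.numTrials (fun i => X i ω) (fun i => U i ω) : ℝ≥0∞) ∂P ≤ C := by
  exact ⟨ReciprocalHalf.algorithm,
    (ReciprocalHalf.stateMean ReciprocalHalf.siteBound 2 ReciprocalHalf.algorithm.init).toNNReal,
    fun _ hp hp1 _ _ _ _ _ _ h => ReciprocalHalf.algorithm_spec hp hp1 h⟩
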